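/- Let $B$ be a Boolean algebra. Let $S(B)$ be its Stone space: the set of ultrafilters on $B$ with the topology generated by the sets $K(b)=\{x\in S(B): b\in x\}$, $b\in B$. Let $\mathrm{ba}(B)$ be the space of all bounded functions $f:B\to\mathbb R$ that are additive, i.e. $f(x\vee y)=f(x)+f(y)$ whenever $x\wedge y=0$, with the norm $\|f\|=\sup_{b\in B}f(b)-\inf_{b\in B}f(b)$. Let $\mathrm{rca}(S(B))$ be the space of all regular countably additive (finite, signed) Borel measures on $S(B)$, with the total variation norm $\|\mu\|=|\mu|(S(B))$. Both are Banach spaces, and the following hold. 1. The map $C_K:\mathrm{rca}(S(B))\to\mathrm{ba}(B)$ defined by $C_K(\mu)(b)=\mu(K(b))$ is an isometric linear isomorphism onto $\mathrm{ba}(B)$. 2. $C_K$ restricts to a bijection from the set $\mathrm{Pr}(S(B))$ of regular Borel probability measures on $S(B)$ onto the set $\mathrm{ba}_1(B)$ of all non-negative additive functions $f$ on $B$ with $f(1)=1$. 3. Let $(\mu_n)_{n\in\mathbb N}$ be a sequence in $\mathrm{rca}(S(B))$ and let $f_n=C_K(\mu_n)$. For every $\mu\in\mathrm{rca}(S(B))$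 with $f=C_K(\mu)$, one has $\int g\,d\mu_n\to\int g\,d\mu$ for all continuous $g:S(B)\to\mathbb R$ (weak* convergence) if and only if $\sup_n\|f_n\|<\infty$ and $f_n(b)\to f(b)$ for all $b\in B$. Likewise, $\left(\int g\,d\mu_n\right)_n$ converges in $\mathbb R$ for every continuous $g$ if and only if $\sup_n\|f_n\|<\infty$ and $(f_n(b))_n$ converges in $\mathbb R$ for every $b\in B$. In particular, weak* convergence and pointwise convergence are equivalent for norm-bounded sequences, hence for sequences in $\mathrm{Pr}(S(B))$: both equivalences hold for these without the boundedness condition. -/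

import Mathlib

open MeasureTheory Filter Topology

/-! ### The Stone space of a Boolean algebra -/

/-- The points of the Stone space `S(B)`: the ultrafilters on `B`. In a Boolean algebra these are
exactly the prime filters (filters whose complement is an ideal; in particular they are proper). -/
def StoneSpace (B : Type*) [BooleanAlgebra B] : Type _ :=
  {F : Order.PFilter B // F.IsPrime}

namespace StoneSpace

variable {B : Type*} [BooleanAlgebra B]

/-- The set `K(b)` of all ultrafilters which contain `b`. -/
def K (b : B) : Set (StoneSpace B) := {x | b ∈ x.1}

/-- The topology of `S(B)` is generated by the sets `K(b)`. -/
instance : TopologicalSpace (StoneSpace B) :=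
  TopologicalSpace.generateFrom (Set.range (K (B := B)))

/-- `S(B)` carries its Borel σ-algebra. -/
instance : MeasurableSpace (StoneSpace B) := borel _

instance : BorelSpace (StoneSpace B) := ⟨rfl⟩

theorem isOpen_K (b : B) : IsOpen (K b) :=
  TopologicalSpace.isOpen_generateFrom_of_mem ⟨b, rfl⟩

theorem bot_notMem (x : StoneSpace B) : (⊥ : B) ∉ x.1 := by
  intro h
  obtain ⟨a, ha⟩ := x.2.compl_ideal.Nonempty
  exact ha (Order.PFilter.mem_of_le bot_le h)

theorem compl_mem_iff (x : StoneSpace B) (b : B) : bᶜ ∈ x.1 ↔ b ∉ x.1 := by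
  constructor
  · intro h h'
    apply bot_notMem x
    rw [← inf_compl_eq_bot (a := b)]
    exact Order.PFilter.inf_mem h' h
  · intro h
    by_contra h'
    obtain ⟨c, hc, hbc, hbc'⟩ := x.2.compl_ideal.Directed b h bᶜ h'
    apply hc
    have : c = ⊤ := by
      rw [← top_le_iff, ← sup_compl_eq_top (x := b)]
      exact sup_le hbc hbc'
    rw [this]
    exact Order.PFilter.top_mem

instance : T2Space (StoneSpace B) where
  t2 := by
    intro x y hxy
    have key : ∀ u v : StoneSpace B, ∀ b, b ∈ u.1 → b ∉ v.1 →
        IsOpen (K b) ∧ IsOpen (K bᶜ) ∧ u ∈ K b ∧ v ∈ K bᶜ ∧ Disjoint (K b) (K bᶜ) := by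
      intro u v b hu hv
      refine ⟨isOpen_K b, isOpen_K _, hu, (compl_mem_iff v b).2 hv, ?_⟩
      rw [Set.disjoint_left]
      intro z hz hz'
      exact (compl_mem_iff z b).1 hz' hz
    by_cases h : ∃ b, b ∈ x.1 ∧ b ∉ y.1
    · obtain ⟨b, hx, hy⟩ := h
      exact ⟨_, _, key x y b hx hy⟩
    · push Not at h
      have h2 : ∃ b, b ∈ y.1 ∧ b ∉ x.1 := by
        by_contra h3
        push Not at h3
        exact hxy (Subtype.ext (Order.PFilter.ext _ _ (Set.Subset.antisymm h h3)))
      obtain ⟨b, hy, hx⟩ := h2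
      obtain ⟨h1, h2, h3, h4, h5⟩ := key y x b hy hx
      exact ⟨_, _, h2, h1, h4, h3, h5.symm⟩

end StoneSpace

/-! ### Bounded additive functions on a Boolean algebra -/

/-- The vector space of bounded additive real-valued functions on `B`. -/
def baSubmodule (B : Type*) [BooleanAlgebra B] : Submodule ℝ (B → ℝ) where
  carrier := {f | (∀ x y : B, x ⊓ y = ⊥ → f (x ⊔ y) = f x + f y) ∧ ∃ C : ℝ, ∀ x, |f x| ≤ C}
  zero_mem' := ⟨fun _ _ _ => by simp, 0, fun _ => by simp⟩
  add_mem' := by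
    rintro f g ⟨hf, C, hC⟩ ⟨hg, D, hD⟩
    refine ⟨fun x y h => ?_, C + D, fun x => (abs_add_le _ _).trans (add_le_add (hC x) (hD x))⟩
    simp only [Pi.add_apply, hf x y h, hg x y h]
    ring
  smul_mem' := by
    rintro c f ⟨hf, C, hC⟩
    refine ⟨fun x y h => ?_, |c| * C, fun x => ?_⟩
    · simp only [Pi.smul_apply, smul_eq_mul, hf x y h]
      ring
    · simp only [Pi.smul_apply, smul_eq_mul, abs_mul]
      exact mul_le_mul_of_nonneg_left (hC x) (abs_nonneg c)

/-- The space `ba(B)`. It is a type of its own, so that it carries the norm topology and not the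
topology of pointwise convergence. -/
def BA (B : Type*) [BooleanAlgebra B] : Type _ := baSubmodule B

namespace BA

variable {B : Type*} [BooleanAlgebra B]

noncomputable instance : AddCommGroup (BA B) := inferInstanceAs (AddCommGroup (baSubmodule B))

noncomputable instance : Module ℝ (BA B) := inferInstanceAs (Module ℝ (baSubmodule B))

instance : FunLike (BA B) B ℝ where
  coe f := f.1
  coe_injective _ _ h := Subtype.ext h

/-- The norm `‖f‖ = sup f - inf f`. -/
noncomputable instance : Norm (BA B) := ⟨fun f => (⨆ b, f b) - ⨅ b, f b⟩

theorem norm_def (f : BA B) : ‖f‖ = (⨆ b, f b) - ⨅ b, f b := rfl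

theorem add_apply (f g : BA B) (b : B) : (f + g) b = f b + g b := rfl

theorem smul_apply (c : ℝ) (f : BA B) (b : B) : (c • f) b = c * f b := rfl

theorem zero_apply (b : B) : (0 : BA B) b = 0 := rfl

theorem bddAbove (f : BA B) : BddAbove (Set.range f) := by
  obtain ⟨C, hC⟩ := f.2.2
  exact ⟨C, by rintro _ ⟨x, rfl⟩; exact (abs_le.1 (hC x)).2⟩

theorem bddBelow (f : BA B) : BddBelow (Set.range f) := by
  obtain ⟨C, hC⟩ := f.2.2
  exact ⟨-C, by rintro _ ⟨x, rfl⟩; exact (abs_le.1 (hC x)).1⟩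

theorem map_bot (f : BA B) : f ⊥ = 0 := by
  have h : f (⊥ ⊔ ⊥) = f ⊥ + f ⊥ := f.2.1 ⊥ ⊥ (by simp)
  rw [sup_idem] at h
  linarith

theorem sub_le_norm (f : BA B) (x y : B) : f x - f y ≤ ‖f‖ :=
  sub_le_sub (le_ciSup f.bddAbove x) (ciInf_le f.bddBelow y)

theorem norm_le (f : BA B) (C : ℝ) (h : ∀ x y, f x - f y ≤ C) : ‖f‖ ≤ C := by
  rw [norm_def]
  have h1 : ∀ y, (⨆ b, f b) ≤ C + f y := fun y => ciSup_le fun x => by linarith [h x y]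
  have h2 : (⨆ b, f b) - C ≤ ⨅ b, f b := le_ciInf fun y => by linarith [h1 y]
  linarith

theorem core : NormedSpace.Core ℝ (BA B) where
  norm_nonneg f := by simpa using f.sub_le_norm ⊥ ⊥
  norm_smul c f := by
    have key : ∀ (c : ℝ) (f : BA B), ‖c • f‖ ≤ |c| * ‖f‖ := by
      intro c f
      refine norm_le _ _ fun x y => ?_
      rw [smul_apply, smul_apply, ← mul_sub]
      refine (le_abs_self _).trans ?_
      rw [abs_mul]
      refine mul_le_mul_of_nonneg_left ?_ (abs_nonneg c)
      rw [abs_le]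
      constructor
      · linarith [f.sub_le_norm y x]
      · exact f.sub_le_norm x y
    rw [Real.norm_eq_abs]
    refine le_antisymm (key c f) ?_
    rcases eq_or_ne c 0 with rfl | hc
    · rw [abs_zero, zero_mul]
      simpa using (((0 : ℝ) • f).sub_le_norm ⊥ ⊥)
    · have h := key c⁻¹ (c • f)
      rw [inv_smul_smul₀ hc, abs_inv] at h
      have hc' : 0 < |c| := abs_pos.2 hc
      calc |c| * ‖f‖ ≤ |c| * (|c|⁻¹ * ‖c • f‖) := mul_le_mul_of_nonneg_left h hc'.le
        _ = ‖c • f‖ := by field_simp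
  norm_triangle f g := by
    refine norm_le _ _ fun x y => ?_
    rw [add_apply, add_apply]
    linarith [f.sub_le_norm x y, g.sub_le_norm x y]
  norm_eq_zero_iff f := by
    constructor
    · intro h
      refine DFunLike.ext _ _ fun x => ?_
      have h1 := f.sub_le_norm x ⊥
      have h2 := f.sub_le_norm ⊥ x
      rw [h, map_bot] at h1 h2
      rw [zero_apply]
      linarith
    · rintro rfl
      simp [norm_def, zero_apply]

noncomputable instance : NormedAddCommGroup (BA B) := NormedAddCommGroup.ofCore core

noncomputable instance : NormedSpace ℝ (BA B) := NormedSpace.ofCore core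

end BA

/-- The set `ba₁(B)` of all positive additive functions `f` on `B` such that `f 1 = 1`. -/
def BA.normalized (B : Type*) [BooleanAlgebra B] : Set (BA B) :=
  {f | (∀ b, 0 ≤ f b) ∧ f ⊤ = 1}

/-! ### Regular countably additive measures -/

theorem isFiniteMeasure_variation {X : Type*} [MeasurableSpace X] (μ : SignedMeasure X) :
    IsFiniteMeasure μ.variation := by
  rw [← SignedMeasure.totalVariation_eq_variation]
  infer_instance

section Regularity

variable {X : Type*} [TopologicalSpace X] [T2Space X] [MeasurableSpace X] [BorelSpace X]

theorem regular_of_le {m n : Measure X} [IsFiniteMeasure n] [n.Regular] (h : m ≤ n) :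
    m.Regular := by
  have hm : IsFiniteMeasure m := isFiniteMeasure_of_le n h
  refine { outerRegular := ?_, innerRegular := ?_ }
  · intro A hA r hr
    have hε : r - m A ≠ 0 := (tsub_pos_of_lt hr).ne'
    obtain ⟨U, hAU, hU, -, hd⟩ := hA.exists_isOpen_sdiff_lt (measure_ne_top n A) hε
    refine ⟨U, hAU, hU, ?_⟩
    calc m U ≤ m A + m (U \ A) := by
          conv_lhs => rw [← Set.union_sdiff_cancel hAU]
          exact measure_union_le _ _
      _ < m A + (r - m A) :=
          ENNReal.add_lt_add_left (measure_ne_top m A) ((h _).trans_lt hd)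
      _ = r := add_tsub_cancel_of_le hr.le
  · intro U hU r hr
    have hε : m U - r ≠ 0 := (tsub_pos_of_lt hr).ne'
    obtain ⟨C, hCU, hC, hd⟩ :=
      hU.measurableSet.exists_isCompact_sdiff_lt (measure_ne_top n U) hε
    refine ⟨C, hCU, hC, ?_⟩
    have h1 : m U ≤ m C + m (U \ C) := by
      conv_lhs => rw [← Set.union_sdiff_cancel hCU]
      exact measure_union_le _ _
    have h2 : m (U \ C) < m U - r := (h _).trans_lt hd
    by_contra hlt
    push Not at hlt
    have h3 : m U < r + (m U - r) :=
      h1.trans_lt (ENNReal.add_lt_add_of_le_of_lt (measure_ne_top m C) hlt h2)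
    rw [add_tsub_cancel_of_le hr.le] at h3
    exact lt_irrefl _ h3

theorem regular_add {m n : Measure X} [IsFiniteMeasure m] [IsFiniteMeasure n] [m.Regular]
    [n.Regular] : (m + n).Regular := by
  have h : (m + n).InnerRegularCompactLTTop := inferInstance
  infer_instance

variable (X) in
/-- The vector space of regular countably additive (finite, signed) Borel measures on `X`: those
whose variation `|μ|` is a regular measure. -/
noncomputable def rcaSubmodule : Submodule ℝ (SignedMeasure X) where
  carrier := {μ | μ.variation.Regular}
  zero_mem' := by
    rw [Set.mem_ofPred_eq, VectorMeasure.variation_zero]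
    infer_instance
  add_mem' := by
    intro μ ν hμ hν
    have h1 := isFiniteMeasure_variation μ
    have h2 := isFiniteMeasure_variation ν
    have h3 : μ.variation.Regular := hμ
    have h4 : ν.variation.Regular := hν
    have h5 : (μ.variation + ν.variation).Regular := regular_add
    exact regular_of_le VectorMeasure.variation_add_le
  smul_mem' := by
    intro c μ hμ
    have h1 : μ.variation.Regular := hμ
    rw [Set.mem_ofPred_eq, VectorMeasure.variation_smul]
    infer_instance

variable (X) in
/-- The space `rca(X)`. -/
def RCA : Type _ := rcaSubmodule X

namespace RCA

noncomputable instance : AddCommGroup (RCA X) := inferInstanceAs (AddCommGroup (rcaSubmodule X))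

noncomputable instance : Module ℝ (RCA X) := inferInstanceAs (Module ℝ (rcaSubmodule X))

/-- The signed measure underlying an element of `rca(X)`. -/
def toSigned (μ : RCA X) : SignedMeasure X := μ.1

/-- The total variation norm `‖μ‖ = |μ|(X)`. -/
noncomputable instance : Norm (RCA X) := ⟨fun μ => μ.toSigned.variation.real Set.univ⟩

theorem norm_def (μ : RCA X) : ‖μ‖ = μ.toSigned.variation.real Set.univ := rfl

theorem toSigned_add (μ ν : RCA X) : (μ + ν).toSigned = μ.toSigned + ν.toSigned := rfl

theorem toSigned_smul (c : ℝ) (μ : RCA X) : (c • μ).toSigned = c • μ.toSigned := rfl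

theorem core : NormedSpace.Core ℝ (RCA X) where
  norm_nonneg μ := measureReal_nonneg
  norm_smul c μ := by
    rw [norm_def, norm_def, toSigned_smul, VectorMeasure.variation_smul,
      measureReal_nnreal_smul_apply, coe_nnnorm]
  norm_triangle μ ν := by
    have h1 := isFiniteMeasure_variation μ.toSigned
    have h2 := isFiniteMeasure_variation ν.toSigned
    rw [norm_def, norm_def, norm_def, toSigned_add, ← measureReal_add_apply]
    exact ENNReal.toReal_mono (measure_ne_top _ _) (VectorMeasure.variation_add_le _)
  norm_eq_zero_iff μ := by
    have h1 := isFiniteMeasure_variation μ.toSigned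
    rw [norm_def, measureReal_eq_zero_iff, Measure.measure_univ_eq_zero,
      VectorMeasure.variation_eq_zero]
    exact ⟨fun h => Subtype.ext h, fun h => congrArg Subtype.val h⟩

noncomputable instance : NormedAddCommGroup (RCA X) := NormedAddCommGroup.ofCore core

noncomputable instance : NormedSpace ℝ (RCA X) := NormedSpace.ofCore core

/-- The integral `∫ g dμ` of a continuous function. -/
noncomputable def integral (μ : RCA X) (g : C(X, ℝ)) : ℝ := ∫ᵛ x, g x ∂<•μ.toSigned

variable (X) in
/-- The set `Pr(X)` of all (regular) probability measures on `X`. -/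
def probability : Set (RCA X) :=
  {μ | ∃ P : ProbabilityMeasure X, μ.toSigned = (P : Measure X).toSignedMeasure}

end RCA

end Regularity

/-! The sets `K b` are clopen, form a basis closed under finite unions, and by compactness one of
them fits between any compact set and any open set around it. Hence a regular measure is determined
by its values on them, and `exists_K_near` lets a Hahn set be replaced by some `K b`. This yields
the isometry `norm_toBA`: the oscillation of `f` is nearly attained at a pair `b`, `bᶜ`. For
surjectivity, `exists_nonneg_sub` splits `f` into nonnegative parts, and `exists_measure` extends
each part to a regular measure by means of a content on compact sets. For convergence,
`exists_mem_span_indicatorK_near` makes combinations of indicators of the `K b` uniformly dense in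
the continuous functions, so under a norm bound it suffices to test on the `K b`. Conversely,
Banach–Steinhaus makes a weak* convergent sequence bounded. -/

namespace StoneSpace

variable {B : Type*} [BooleanAlgebra B]

/-! ### Stone representation and compactness -/

theorem K_top : K (⊤ : B) = Set.univ :=
  Set.eq_univ_of_forall fun _ => Order.PFilter.top_mem

theorem K_bot : K (⊥ : B) = ∅ :=
  Set.eq_empty_of_forall_notMem bot_notMem

theorem K_inf (a b : B) : K (a ⊓ b) = K a ∩ K b :=
  Set.ext fun _ => Order.PFilter.inf_mem_iff

theorem K_compl (b : B) : K bᶜ = (K b)ᶜ :=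
  Set.ext fun x => compl_mem_iff x b

theorem K_sup (a b : B) : K (a ⊔ b) = K a ∪ K b := by
  rw [← compl_compl (a ⊔ b), compl_sup, K_compl, K_inf, K_compl, K_compl, Set.compl_inter,
    compl_compl, compl_compl]

theorem K_mono {a b : B} (h : a ≤ b) : K a ⊆ K b :=
  fun _ hx => Order.PFilter.mem_of_le h hx

theorem isClopen_K (b : B) : IsClopen (K b) :=
  ⟨⟨by rw [← K_compl]; exact isOpen_K _⟩, isOpen_K b⟩

/-- The Boolean prime ideal theorem: every nonzero element lies in an ultrafilter. -/
theorem K_nonempty {b : B} (hb : b ≠ ⊥) : (K b).Nonempty := by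
  have hd : Disjoint (Order.PFilter.principal b : Set B) (Order.Ideal.principal (⊥ : B) : Set B) := by
    rw [Set.disjoint_left]
    intro x hx hx'
    exact hb (le_bot_iff.1 (le_trans hx hx'))
  obtain ⟨J, hJ, -, hJF⟩ := DistribLattice.prime_ideal_of_disjoint_filter_ideal hd
  refine ⟨⟨hJ.toPrimePair.F, hJ.toPrimePair.F_isPrime⟩, ?_⟩
  exact Set.disjoint_left.1 hJF (show b ≤ b from le_rfl)

theorem K_subset_iff {a b : B} : K a ⊆ K b ↔ a ≤ b := by
  refine ⟨fun h => ?_, K_mono⟩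
  by_contra hab
  have hne : a ⊓ bᶜ ≠ ⊥ := fun h0 => hab (by rwa [← sdiff_eq, sdiff_eq_bot_iff] at h0)
  obtain ⟨x, hx⟩ := K_nonempty hne
  rw [K_inf, K_compl] at hx
  exact hx.2 (h hx.1)

theorem K_injective : Function.Injective (K (B := B)) := fun _ _ h =>
  le_antisymm (K_subset_iff.1 h.subset) (K_subset_iff.1 h.superset)

theorem disjoint_K_iff {a b : B} : Disjoint (K a) (K b) ↔ a ⊓ b = ⊥ := by
  rw [Set.disjoint_iff_inter_eq_empty, ← K_inf, ← K_bot]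
  exact K_injective.eq_iff

/-- The trace on `B` of an ultrafilter of subsets of the Stone space. -/
def limit (F : Ultrafilter (StoneSpace B)) : StoneSpace B :=
  ⟨(Order.IsPFilter.of_def (F := {b : B | K b ∈ F})
      ⟨⊤, by rw [Set.mem_ofPred_eq, K_top]; exact Filter.univ_mem⟩
      (fun a ha b hb => ⟨a ⊓ b, by rw [Set.mem_ofPred_eq, K_inf]; exact Filter.inter_mem ha hb,
        inf_le_left, inf_le_right⟩)
      (fun h ha => Filter.mem_of_superset ha (K_mono h))).toPFilter, ⟨by
    constructor
    · intro a b hab ha hb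
      exact ha (Filter.mem_of_superset hb (K_mono hab))
    · refine ⟨⊥, fun h => ?_⟩
      have h' : K (⊥ : B) ∈ F := h
      rw [K_bot] at h'
      exact F.empty_notMem h'
    · intro a ha b hb
      refine ⟨a ⊔ b, fun h => ?_, le_sup_left, le_sup_right⟩
      have h' : K (a ⊔ b) ∈ F := h
      rw [K_sup, Ultrafilter.union_mem_iff] at h'
      exact h'.elim ha hb⟩⟩

/-- The neighbourhood filter of a point is generated by the sets `K b` containing it; those
containing `limit F` belong to `F` by construction. -/
instance : CompactSpace (StoneSpace B) := by
  refine ⟨isCompact_iff_ultrafilter_le_nhds.2 fun F _ => ⟨limit F, Set.mem_univ _, ?_⟩⟩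
  rw [TopologicalSpace.nhds_generateFrom]
  refine le_iInf₂ fun s hs => ?_
  obtain ⟨hx, b, rfl⟩ := hs
  exact Filter.le_principal_iff.2 hx

theorem isTopologicalBasis_K : TopologicalSpace.IsTopologicalBasis (Set.range (K (B := B))) where
  exists_subset_inter := by
    rintro _ ⟨a, rfl⟩ _ ⟨b, rfl⟩ x hx
    exact ⟨K (a ⊓ b), ⟨_, rfl⟩, by rwa [K_inf], (K_inf a b).subset⟩
  sUnion_eq := Set.eq_univ_of_forall fun _ =>
    ⟨K ⊤, ⟨⊤, rfl⟩, by rw [K_top]; trivial⟩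
  eq_generateFrom := rfl

/-- Finitely many basic sets inside `U` cover `Z`, and `K_sup` makes their union basic again. -/
theorem exists_K_between {Z U : Set (StoneSpace B)} (hZ : IsCompact Z) (hU : IsOpen U)
    (h : Z ⊆ U) : ∃ b : B, Z ⊆ K b ∧ K b ⊆ U := by
  refine hZ.induction_on (p := fun s => ∃ b : B, s ⊆ K b ∧ K b ⊆ U) ?_ ?_ ?_ ?_
  · exact ⟨⊥, Set.empty_subset _, by rw [K_bot]; exact Set.empty_subset _⟩
  · rintro s t hst ⟨b, hb, hbU⟩
    exact ⟨b, hst.trans hb, hbU⟩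
  · rintro s t ⟨a, ha, haU⟩ ⟨b, hb, hbU⟩
    exact ⟨a ⊔ b, by rw [K_sup]; exact Set.union_subset_union ha hb,
      by rw [K_sup]; exact Set.union_subset haU hbU⟩
  · intro x hx
    obtain ⟨_, ⟨b, rfl⟩, hxb, hbU⟩ := isTopologicalBasis_K.exists_subset_of_mem_open (h hx) hU
    exact ⟨K b, mem_nhdsWithin_of_mem_nhds ((isOpen_K b).mem_nhds hxb), b, subset_rfl, hbU⟩

/-! ### Uniform approximation of continuous functions -/

/-- The indicator function of `K b`, as a continuous function. -/
noncomputable def indicatorK (b : B) : C(StoneSpace B, ℝ) :=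
  ⟨(K b).indicator fun _ => 1, continuous_const.indicator (by simp [(isClopen_K b).frontier_eq])⟩

theorem indicatorK_apply (b : B) (x : StoneSpace B) :
    indicatorK b x = (K b).indicator (fun _ => (1 : ℝ)) x := rfl

theorem indicatorK_of_mem {b : B} {x : StoneSpace B} (h : x ∈ K b) : indicatorK b x = 1 := by
  rw [indicatorK_apply, Set.indicator_of_mem h]

theorem indicatorK_of_notMem {b : B} {x : StoneSpace B} (h : x ∉ K b) : indicatorK b x = 0 := by
  rw [indicatorK_apply, Set.indicator_of_notMem h]

theorem exists_mem_span_indicatorK_near (g : C(StoneSpace B, ℝ)) {ε : ℝ} (hε : 0 < ε) :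
    ∃ h ∈ Submodule.span ℝ (Set.range (indicatorK (B := B))), ∀ x, |g x - h x| ≤ ε := by
  -- The induction over compactness needs a claim that survives unions. Allowing every `c ≤ b` lets
  -- overlapping pieces be cut down to the disjoint `c ⊓ a` and `c ⊓ aᶜ`; since each approximant
  -- vanishes off its piece, the two can be added.
  suffices hyp : ∃ b : B, Set.univ ⊆ K b ∧ ∀ c ≤ b,
      ∃ h ∈ Submodule.span ℝ (Set.range (indicatorK (B := B))),
        (∀ x ∈ K c, |g x - h x| ≤ ε) ∧ ∀ x ∉ K c, h x = 0 by
    obtain ⟨b, hb, H⟩ := hyp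
    obtain ⟨h, hh, hc, -⟩ := H b le_rfl
    exact ⟨h, hh, fun x => hc x (hb (Set.mem_univ x))⟩
  refine isCompact_univ.induction_on
    (p := fun s => ∃ b : B, s ⊆ K b ∧ ∀ c ≤ b,
      ∃ h ∈ Submodule.span ℝ (Set.range (indicatorK (B := B))),
        (∀ x ∈ K c, |g x - h x| ≤ ε) ∧ ∀ x ∉ K c, h x = 0) ?_ ?_ ?_ ?_
  · refine ⟨⊥, Set.empty_subset _, fun c hc => ⟨0, zero_mem _, fun x hx => ?_, fun _ _ => rfl⟩⟩
    exact (bot_notMem x (Order.PFilter.mem_of_le hc hx)).elim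
  · rintro s t hst ⟨b, hb, H⟩
    exact ⟨b, hst.trans hb, H⟩
  · rintro s t ⟨a, ha, Ha⟩ ⟨b, hb, Hb⟩
    refine ⟨a ⊔ b, by rw [K_sup]; exact Set.union_subset_union ha hb, fun c hc => ?_⟩
    obtain ⟨h₁, hs₁, hc₁, hz₁⟩ := Ha (c ⊓ a) inf_le_right
    obtain ⟨h₂, hs₂, hc₂, hz₂⟩ := Hb (c ⊓ aᶜ) (by
      rw [← sdiff_eq, sdiff_le_iff]; exact hc)
    simp only [K_inf, K_compl, Set.mem_inter_iff, Set.mem_compl_iff] at hc₁ hz₁ hc₂ hz₂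
    refine ⟨h₁ + h₂, add_mem hs₁ hs₂, fun x hx => ?_, fun x hx => ?_⟩
    · rw [ContinuousMap.add_apply]
      by_cases hxa : x ∈ K a
      · rw [hz₂ x (by tauto), add_zero]
        exact hc₁ x ⟨hx, hxa⟩
      · rw [hz₁ x (by tauto), zero_add]
        exact hc₂ x ⟨hx, hxa⟩
    · rw [ContinuousMap.add_apply, hz₁ x (by tauto), hz₂ x (by tauto), add_zero]
  · intro x _
    obtain ⟨_, ⟨b, rfl⟩, hxb, hb⟩ := isTopologicalBasis_K.exists_subset_of_mem_open
      (show x ∈ g ⁻¹' Metric.ball (g x) ε from Metric.mem_ball_self hε)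
      (Metric.isOpen_ball.preimage g.continuous)
    refine ⟨K b, mem_nhdsWithin_of_mem_nhds ((isOpen_K b).mem_nhds hxb), b, subset_rfl,
      fun c hc => ⟨g x • indicatorK c, Submodule.smul_mem _ _ (Submodule.subset_span ⟨c, rfl⟩),
        fun y hy => ?_, fun y hy => ?_⟩⟩
    · rw [ContinuousMap.smul_apply, indicatorK_of_mem hy, smul_eq_mul, mul_one]
      have := hb (K_mono hc hy)
      rw [Set.mem_preimage, Metric.mem_ball, Real.dist_eq] at this
      exact this.le
    · rw [ContinuousMap.smul_apply, indicatorK_of_notMem hy, smul_zero]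

end StoneSpace

/-! ### Variation of signed measures -/

namespace MeasureTheory.SignedMeasure

variable {X : Type*} [MeasurableSpace X]

theorem sub_eq_sdiff_sub_sdiff (μ : SignedMeasure X) {s t : Set X} (hs : MeasurableSet s)
    (ht : MeasurableSet t) : μ s - μ t = μ (s \ t) - μ (t \ s) := by
  have h1 := VectorMeasure.of_add_of_sdiff (v := μ) (hs.inter ht) hs Set.inter_subset_left
  have h2 := VectorMeasure.of_add_of_sdiff (v := μ) (hs.inter ht) ht Set.inter_subset_right
  rw [Set.sdiff_self_inter] at h1
  rw [Set.inter_comm, Set.sdiff_self_inter, Set.inter_comm] at h2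
  linarith

theorem abs_le_variation_real (μ : SignedMeasure X) (s : Set X) : |μ s| ≤ μ.variation.real s := by
  have := isFiniteMeasure_variation μ
  exact VectorMeasure.norm_measure_le_variation (μ := μ) (measure_ne_top _ _)

theorem abs_sub_le_variation_real (μ : SignedMeasure X) {s t : Set X} (hs : MeasurableSet s)
    (ht : MeasurableSet t) : |μ s - μ t| ≤ μ.variation.real (s \ t) + μ.variation.real (t \ s) := by
  rw [sub_eq_sdiff_sub_sdiff μ hs ht]
  exact (abs_sub _ _).trans
    (add_le_add (abs_le_variation_real μ _) (abs_le_variation_real μ _))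

/-- The common part `s ∩ t` cancels and the two differences are disjoint, so the constant is 1
rather than 2. This is what matches the norm `sup - inf`. -/
theorem sub_le_variation_real_univ (μ : SignedMeasure X) {s t : Set X} (hs : MeasurableSet s)
    (ht : MeasurableSet t) : μ s - μ t ≤ μ.variation.real Set.univ := by
  have := isFiniteMeasure_variation μ
  refine (le_abs_self _).trans ((abs_sub_le_variation_real μ hs ht).trans ?_)
  rw [← measureReal_union (by exact disjoint_sdiff_sdiff) (ht.diff hs)]
  exact measureReal_mono (Set.subset_univ _)

/-- Take the positive set of a Hahn decomposition. -/
theorem exists_variation_real_univ_eq (μ : SignedMeasure X) :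
    ∃ s, MeasurableSet s ∧ μ.variation.real Set.univ = μ s - μ sᶜ := by
  obtain ⟨s, hs, hpos, hneg, h1, h2⟩ := μ.toJordanDecomposition_spec
  refine ⟨s, hs, ?_⟩
  rw [← totalVariation_eq_variation, totalVariation, h1, h2, measureReal_add_apply,
    toMeasureOfZeroLE_real_apply _ _ _ .univ, toMeasureOfLEZero_real_apply _ _ _ .univ,
    Set.inter_univ, Set.inter_univ, sub_eq_add_neg]

end MeasureTheory.SignedMeasure

/-! ### The isometric embedding of `rca(S(B))` into `ba(B)` -/

namespace StoneSpace

variable {B : Type*} [BooleanAlgebra B]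

theorem measurableSet_K (b : B) : MeasurableSet (K b) := (isOpen_K b).measurableSet

/-- Measurable sets are approximated by the sets `K b` with respect to finite regular measures. -/
theorem exists_K_near (m : Measure (StoneSpace B)) [IsFiniteMeasure m] [m.Regular]
    {s : Set (StoneSpace B)} (hs : MeasurableSet s) {ε : ℝ} (hε : 0 < ε) :
    ∃ b : B, m.real (s \ K b) ≤ ε ∧ m.real (K b \ s) ≤ ε := by
  have hε' : ENNReal.ofReal ε ≠ 0 := by simpa using hε
  obtain ⟨Z, hZs, hZ, hZm⟩ := hs.exists_isCompact_sdiff_lt (measure_ne_top m s) hε'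
  obtain ⟨U, hsU, hU, -, hUm⟩ := hs.exists_isOpen_sdiff_lt (measure_ne_top m s) hε'
  -- With `Z ⊆ K b ⊆ U`, the two errors lie in `s \ Z` and `U \ s`.
  obtain ⟨b, hZb, hbU⟩ := exists_K_between hZ hU (hZs.trans hsU)
  refine ⟨b, ENNReal.toReal_le_of_le_ofReal hε.le ?_, ENNReal.toReal_le_of_le_ofReal hε.le ?_⟩
  · exact (measure_mono (Set.sdiff_subset_sdiff_right hZb)).trans hZm.le
  · exact (measure_mono (Set.sdiff_subset_sdiff_left hbU)).trans hUm.le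

end StoneSpace

/-- Bundles a bounded additive function as an element of `ba(B)`. -/
def BA.ofFun {B : Type*} [BooleanAlgebra B] (f : B → ℝ)
    (hf : ∀ x y : B, x ⊓ y = ⊥ → f (x ⊔ y) = f x + f y) (hC : ∃ C : ℝ, ∀ x, |f x| ≤ C) : BA B :=
  ⟨f, hf, hC⟩

namespace RCA

variable {B : Type*} [BooleanAlgebra B]

open StoneSpace

/-- The additive function `b ↦ μ (K b)`. -/
def toBA (μ : RCA (StoneSpace B)) : BA B :=
  BA.ofFun (fun b => μ.toSigned (K b))
    (fun x y h => by
      rw [K_sup,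
        VectorMeasure.of_union (disjoint_K_iff.2 h) (measurableSet_K x) (measurableSet_K y)])
    ⟨μ.toSigned.variation.real Set.univ, fun x => by
      have := isFiniteMeasure_variation μ.toSigned
      exact (μ.toSigned.abs_le_variation_real _).trans (measureReal_mono (Set.subset_univ _))⟩

theorem toBA_apply (μ : RCA (StoneSpace B)) (b : B) : μ.toBA b = μ.toSigned (K b) := rfl

theorem norm_toBA (μ : RCA (StoneSpace B)) : ‖μ.toBA‖ = ‖μ‖ := by
  refine le_antisymm (BA.norm_le _ _ fun x y =>
    μ.toSigned.sub_le_variation_real_univ (measurableSet_K x) (measurableSet_K y)) ?_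
  have h1 := isFiniteMeasure_variation μ.toSigned
  have h2 : μ.toSigned.variation.Regular := μ.2
  obtain ⟨s, hs, hμ⟩ := μ.toSigned.exists_variation_real_univ_eq
  refine le_of_forall_pos_le_add fun ε hε => ?_
  -- Two errors of `ε / 4` give `|μ s - μ (K b)| ≤ ε / 2`, which is doubled because `μ s - μ sᶜ`
  -- equals `2 * μ s` minus the total mass.
  obtain ⟨b, hb1, hb2⟩ := exists_K_near μ.toSigned.variation hs (ε := ε / 4) (by linarith)
  have h3 := abs_le.1 ((μ.toSigned.abs_sub_le_variation_real hs (measurableSet_K b)).trans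
    (add_le_add hb1 hb2))
  have h4 := μ.toBA.sub_le_norm b bᶜ
  rw [toBA_apply, toBA_apply, K_compl, VectorMeasure.of_compl (measurableSet_K b)] at h4
  rw [norm_def, hμ, VectorMeasure.of_compl hs]
  linarith [h3.1, h3.2]

/-- `toBA` as a linear isometry. -/
def toBAₗᵢ (B : Type*) [BooleanAlgebra B] : RCA (StoneSpace B) →ₗᵢ[ℝ] BA B where
  toFun := toBA
  map_add' μ ν := DFunLike.ext _ _ fun b => by
    rw [BA.add_apply, toBA_apply, toBA_apply, toBA_apply, toSigned_add, _root_.add_apply]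
  map_smul' c μ := DFunLike.ext _ _ fun b => by
    rw [RingHom.id_apply, BA.smul_apply, toBA_apply, toBA_apply, toSigned_smul,
      _root_.smul_apply, smul_eq_mul]
  norm_map' := norm_toBA

end RCA

/-! ### Jordan decomposition and completeness of `ba(B)` -/

namespace BA

variable {B : Type*} [BooleanAlgebra B]

theorem map_sup (f : BA B) {x y : B} (h : x ⊓ y = ⊥) : f (x ⊔ y) = f x + f y := f.2.1 x y h

theorem map_inf_add_sdiff (f : BA B) (x y : B) : f (x ⊓ y) + f (x \ y) = f x := by
  rw [← map_sup f (disjoint_iff.1 disjoint_inf_sdiff), sup_inf_sdiff]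

theorem mono_of_nonneg {f : BA B} (hf : ∀ b, 0 ≤ f b) {x y : B} (h : x ≤ y) : f x ≤ f y := by
  have := f.map_inf_add_sdiff y x
  rw [inf_eq_right.2 h] at this
  linarith [hf (y \ x)]

theorem map_sup_le_of_nonneg {f : BA B} (hf : ∀ b, 0 ≤ f b) (x y : B) :
    f (x ⊔ y) ≤ f x + f y := by
  rw [← sup_sdiff_self_right, map_sup f (disjoint_iff.1 disjoint_sdiff_self_right)]
  exact add_le_add_right (mono_of_nonneg hf sdiff_le) _

theorem bddAbove_lowerPart (f : BA B) (b : B) :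
    BddAbove (Set.range fun a : Set.Iic b => f a) := by
  obtain ⟨C, hC⟩ := f.bddAbove
  exact ⟨C, by rintro _ ⟨a, rfl⟩; exact hC ⟨a, rfl⟩⟩

theorem exists_nonneg_sub (f : BA B) :
    ∃ g h : BA B, (∀ b, 0 ≤ g b) ∧ (∀ b, 0 ≤ h b) ∧ f = g - h := by
  set p : B → ℝ := fun b => ⨆ a : Set.Iic b, f a
  have hle : ∀ {a b : B}, a ≤ b → f a ≤ p b := fun {a b} hab =>
    le_ciSup (f.bddAbove_lowerPart b) (⟨a, hab⟩ : Set.Iic b)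
  have hp0 : ∀ b, 0 ≤ p b := fun b => by
    rw [← f.map_bot]
    exact hle bot_le
  have hne : ∀ b : B, Nonempty (Set.Iic b) := fun b => ⟨⟨b, le_rfl⟩⟩
  have hpC : ∀ b, p b ≤ ‖f‖ := fun b => ciSup_le fun a => by
    have := f.sub_le_norm a ⊥
    rwa [f.map_bot, sub_zero] at this
  -- Elements below `x ⊔ y` split into parts below `x` and `y`; conversely, elements below `x` and
  -- `y` are disjoint and join to one below `x ⊔ y`.
  have hadd : ∀ x y : B, x ⊓ y = ⊥ → p (x ⊔ y) = p x + p y := by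
    intro x y hxy
    apply le_antisymm
    · refine ciSup_le fun a => ?_
      obtain ⟨a, ha⟩ := a
      rw [← f.map_inf_add_sdiff a x]
      exact add_le_add (hle inf_le_right) (hle (sdiff_le_iff.2 ha))
    · refine (le_sub_iff_add_le).1 (ciSup_le fun a => ?_)
      rw [le_sub_comm]
      refine ciSup_le fun c => ?_
      rw [le_sub_iff_add_le, add_comm]
      have : (a : B) ⊓ c = ⊥ := le_bot_iff.1 ((inf_le_inf a.2 c.2).trans hxy.le)
      rw [← f.map_sup this]
      exact hle (sup_le_sup a.2 c.2)
  let g : BA B := ofFun p hadd ⟨‖f‖, fun b => by rw [abs_of_nonneg (hp0 b)]; exact hpC b⟩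
  refine ⟨g, g - f, hp0, fun b => ?_, (sub_sub_cancel g f).symm⟩
  have : (g - f) b = p b - f b := rfl
  rw [this, sub_nonneg]
  exact hle le_rfl

/-- The norm dominates each evaluation, so a Cauchy sequence has a pointwise limit. Letting `m` tend
to infinity in the bounds for `u n - u m` gives convergence in norm. -/
instance : CompleteSpace (BA B) := by
  refine Metric.complete_of_cauchySeq_tendsto fun u hu => ?_
  have hd : ∀ (f g : BA B) (b : B), |f b - g b| ≤ ‖f - g‖ := fun f g b => by
    have e : f b - g b = (f - g) b := rfl
    have h1 := (f - g).sub_le_norm b ⊥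
    have h2 := (f - g).sub_le_norm ⊥ b
    rw [map_bot] at h1 h2
    rw [e, abs_le]
    constructor <;> linarith
  have hc : ∀ b, CauchySeq fun n => u n b := fun b => by
    refine Metric.cauchySeq_iff.2 fun ε hε => ?_
    obtain ⟨N, hN⟩ := Metric.cauchySeq_iff.1 hu ε hε
    refine ⟨N, fun m hm n hn => lt_of_le_of_lt ?_ (hN m hm n hn)⟩
    rw [Real.dist_eq, dist_eq_norm]
    exact hd _ _ b
  choose f hf using fun b => cauchySeq_tendsto_of_complete (hc b)
  obtain ⟨R, -, hR⟩ := cauchySeq_bdd hu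
  have hadd : ∀ x y : B, x ⊓ y = ⊥ → f (x ⊔ y) = f x + f y := fun x y h =>
    tendsto_nhds_unique (hf _) (((hf x).add (hf y)).congr fun n => ((u n).map_sup h).symm)
  have hbdd : ∃ C : ℝ, ∀ x, |f x| ≤ C := by
    refine ⟨‖u 0‖ + R, fun x => le_of_tendsto (hf x).abs (Eventually.of_forall fun n => ?_)⟩
    have h1 := hd (u n) 0 x
    rw [zero_apply, sub_zero, sub_zero] at h1
    have h2 : ‖u n‖ ≤ ‖u 0‖ + ‖u n - u 0‖ := norm_le_insert' _ _
    have h3 := hR n 0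
    rw [dist_eq_norm] at h3
    linarith
  refine ⟨ofFun f hadd hbdd, Metric.tendsto_atTop.2 fun ε hε => ?_⟩
  obtain ⟨N, hN⟩ := Metric.cauchySeq_iff.1 hu (ε / 2) (half_pos hε)
  refine ⟨N, fun n hn => lt_of_le_of_lt ?_ (half_lt_self hε)⟩
  rw [dist_eq_norm]
  refine norm_le _ _ fun x y => ?_
  refine le_of_tendsto (((tendsto_const_nhds (x := u n x)).sub (hf x)).sub
    ((tendsto_const_nhds (x := u n y)).sub (hf y))) ?_
  filter_upwards [eventually_ge_atTop N] with m hm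
  have h1 := (u n - u m).sub_le_norm x y
  have h2 := hN n hn m hm
  rw [dist_eq_norm] at h2
  exact h1.trans h2.le

end BA

/-! ### From nonnegative additive functions to regular measures -/

namespace BA

variable {B : Type*} [BooleanAlgebra B]

open StoneSpace

/-- The outer extension of a nonnegative additive function to subsets of the Stone space: the
infimum of `f b` over all `b` with `Z ⊆ K b`. -/
noncomputable def outer (f : BA B) (Z : Set (StoneSpace B)) : NNReal :=
  ⨅ b : {b : B // Z ⊆ K b}, (f b).toNNReal

theorem outer_le (f : BA B) {Z : Set (StoneSpace B)} {b : B} (h : Z ⊆ K b) :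
    f.outer Z ≤ (f b).toNNReal :=
  ciInf_le' (fun b : {b : B // Z ⊆ K b} => (f b).toNNReal) ⟨b, h⟩

instance (Z : Set (StoneSpace B)) : Nonempty {b : B // Z ⊆ K b} :=
  ⟨⊤, by rw [K_top]; exact Set.subset_univ _⟩

theorem le_outer (f : BA B) {Z : Set (StoneSpace B)} {r : NNReal}
    (h : ∀ b, Z ⊆ K b → r ≤ (f b).toNNReal) : r ≤ f.outer Z :=
  le_ciInf fun b => h b b.2

theorem outer_union_le {f : BA B} (hf : ∀ b, 0 ≤ f b) (Y Z : Set (StoneSpace B)) :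
    f.outer (Y ∪ Z) ≤ f.outer Y + f.outer Z := by
  refine NNReal.le_iInf_add_iInf fun a b => ?_
  rw [← Real.toNNReal_add (hf _) (hf _)]
  refine (f.outer_le (b := a ⊔ b) ?_).trans
    (Real.toNNReal_le_toNNReal (map_sup_le_of_nonneg hf _ _))
  rw [K_sup]
  exact Set.union_subset_union a.2 b.2

/-- Some `K a` contains `Y` and misses `Z`. It splits every `b` covering the union into `b ⊓ a`,
which covers `Y`, and `b \ a`, which covers `Z`. -/
theorem add_outer_le_outer_union {f : BA B} (hf : ∀ b, 0 ≤ f b) {Y Z : Set (StoneSpace B)}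
    (hd : Disjoint Y Z) (hY : IsCompact Y) (hZ : IsClosed Z) :
    f.outer Y + f.outer Z ≤ f.outer (Y ∪ Z) := by
  refine f.le_outer fun b hb => ?_
  rw [Set.union_subset_iff] at hb
  obtain ⟨a, hYa, haZ⟩ := exists_K_between hY hZ.isOpen_compl (Set.disjoint_left.1 hd)
  rw [← f.map_inf_add_sdiff b a, Real.toNNReal_add (hf _) (hf _)]
  refine add_le_add (f.outer_le ?_) (f.outer_le ?_)
  · rw [K_inf]
    exact Set.subset_inter hb.1 hYa
  · rw [sdiff_eq, K_inf, K_compl]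
    exact Set.subset_inter hb.2 (Set.subset_compl_comm.1 haZ)

/-- The content on the Stone space induced by a nonnegative additive function. -/
noncomputable def content (f : BA B) (hf : ∀ b, 0 ≤ f b) : Content (StoneSpace B) where
  toFun Z := f.outer Z
  mono' _ _ h := f.le_outer fun _ hb => f.outer_le (h.trans hb)
  sup_le' Y Z := by
    rw [TopologicalSpace.Compacts.coe_sup]
    exact outer_union_le hf _ _
  sup_disjoint' Y Z hd _ hZ := by
    rw [TopologicalSpace.Compacts.coe_sup]
    exact le_antisymm (outer_union_le hf _ _) (add_outer_le_outer_union hf hd Y.isCompact hZ)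

/-- As `K b` is both open and compact, its measure is its content, and the infimum defining the
content is attained at `b` itself. -/
theorem content_measure_K (f : BA B) (hf : ∀ b, 0 ≤ f b) (b : B) :
    (f.content hf).measure (K b) = ENNReal.ofReal (f b) := by
  rw [Content.measure_apply _ (measurableSet_K b), Content.outerMeasure_of_isOpen _ _ (isOpen_K b),
    Content.innerContent_of_isCompact _ (isClopen_K b).isClosed.isCompact]
  rw [content, Content.mk_apply, ENNReal.ofReal]
  congr 1
  exact le_antisymm (f.outer_le subset_rfl)
    (f.le_outer fun c hc => Real.toNNReal_le_toNNReal (mono_of_nonneg hf (K_subset_iff.1 hc)))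

/-- A nonnegative additive function is represented by a finite regular measure. -/
theorem exists_measure (f : BA B) (hf : ∀ b, 0 ≤ f b) :
    ∃ m : Measure (StoneSpace B), ∃ _ : IsFiniteMeasure m, m.Regular ∧ ∀ b, m.real (K b) = f b := by
  refine ⟨(f.content hf).measure, ⟨?_⟩, inferInstance, fun b => ?_⟩
  · rw [← K_top, content_measure_K]
    exact ENNReal.ofReal_lt_top
  · rw [measureReal_def, content_measure_K, ENNReal.toReal_ofReal (hf b)]

end BA

/-! ### Surjectivity and probability measures -/

namespace RCA

variable {X : Type*} [TopologicalSpace X] [T2Space X] [MeasurableSpace X] [BorelSpace X]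

/-- A finite regular measure as an element of `rca(X)`. -/
noncomputable def ofMeasure (m : Measure X) [IsFiniteMeasure m] (hm : m.Regular) : RCA X :=
  ⟨m.toSignedMeasure, by
    show m.toSignedMeasure.variation.Regular
    rwa [Measure.variation_toSignedMeasure]⟩

theorem toSigned_ofMeasure (m : Measure X) [IsFiniteMeasure m] (hm : m.Regular) :
    (ofMeasure m hm).toSigned = m.toSignedMeasure := rfl

variable {B : Type*} [BooleanAlgebra B]

open StoneSpace

theorem toBA_ofMeasure_apply (m : Measure (StoneSpace B)) [IsFiniteMeasure m] (hm : m.Regular)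
    (b : B) : (ofMeasure m hm).toBA b = m.real (K b) := by
  rw [toBA_apply, toSigned_ofMeasure, Measure.toSignedMeasure_apply_measurable (measurableSet_K b)]

theorem exists_toBA_eq_of_nonneg {f : BA B} (hf : ∀ b, 0 ≤ f b) :
    ∃ m : Measure (StoneSpace B), ∃ _ : IsFiniteMeasure m, ∃ hm : m.Regular,
      (ofMeasure m hm).toBA = f := by
  obtain ⟨m, h, hm, H⟩ := f.exists_measure hf
  exact ⟨m, h, hm, DFunLike.ext _ _ fun b => by rw [toBA_ofMeasure_apply, H]⟩

theorem toBAₗᵢ_surjective : Function.Surjective (toBAₗᵢ B) := by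
  intro f
  obtain ⟨g, h, hg, hh, rfl⟩ := f.exists_nonneg_sub
  obtain ⟨m, _, hm, rfl⟩ := exists_toBA_eq_of_nonneg hg
  obtain ⟨n, _, hn, rfl⟩ := exists_toBA_eq_of_nonneg hh
  exact ⟨ofMeasure m hm - ofMeasure n hn, map_sub (toBAₗᵢ B) _ _⟩

/-- The isometric isomorphism `C_K` of `rca(S(B))` with `ba(B)`. -/
noncomputable def equivBA (B : Type*) [BooleanAlgebra B] : RCA (StoneSpace B) ≃ₗᵢ[ℝ] BA B :=
  LinearIsometryEquiv.ofSurjective (toBAₗᵢ B) toBAₗᵢ_surjective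

theorem equivBA_apply (μ : RCA (StoneSpace B)) : equivBA B μ = μ.toBA := rfl

theorem bijOn_equivBA :
    Set.BijOn (equivBA B) (probability (StoneSpace B)) (BA.normalized B) := by
  refine ⟨?_, (equivBA B).injective.injOn, ?_⟩
  · rintro μ ⟨P, hP⟩
    have key : ∀ b, equivBA B μ b = (P : Measure (StoneSpace B)).real (K b) := fun b => by
      rw [equivBA_apply, toBA_apply, hP,
        Measure.toSignedMeasure_apply_measurable (measurableSet_K b)]
    refine ⟨fun b => by rw [key]; exact measureReal_nonneg, ?_⟩
    rw [key, K_top, probReal_univ]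
  · rintro f ⟨hf, h1⟩
    obtain ⟨m, hfin, hm, rfl⟩ := exists_toBA_eq_of_nonneg hf
    rw [toBA_ofMeasure_apply, K_top] at h1
    have hP : IsProbabilityMeasure m := ⟨by
      rw [← ENNReal.toReal_eq_one_iff]; exact h1⟩
    exact ⟨ofMeasure m hm, ⟨⟨m, hP⟩, rfl⟩, rfl⟩

end RCA

theorem BA.norm_le_one_of_mem_normalized {B : Type*} [BooleanAlgebra B] {f : BA B}
    (hf : f ∈ BA.normalized B) : ‖f‖ ≤ 1 := by
  refine norm_le _ _ fun x y => ?_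
  have := mono_of_nonneg hf.1 (le_top (a := x))
  rw [hf.2] at this
  linarith [hf.1 y]

/-- Completeness is transported from `ba(B)` along the isometry. -/
instance {B : Type*} [BooleanAlgebra B] : CompleteSpace (RCA (StoneSpace B)) :=
  (completeSpace_congr (e := (RCA.equivBA B).toEquiv)
    (RCA.equivBA B).isometry.isUniformEmbedding).2 inferInstance

/-! ### Weak* convergence -/

namespace RCA

variable {B : Type*} [BooleanAlgebra B]

open StoneSpace

theorem integrable_continuousMap (μ : RCA (StoneSpace B)) (g : C(StoneSpace B, ℝ)) :
    μ.toSigned.Integrable g := by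
  have := isFiniteMeasure_variation μ.toSigned
  exact g.continuous.integrable_of_hasCompactSupport (HasCompactSupport.of_compactSpace g)

theorem abs_integral_le (μ : RCA (StoneSpace B)) (g : C(StoneSpace B, ℝ)) {c : ℝ}
    (hg : ∀ x, |g x| ≤ c) : |μ.integral g| ≤ c * ‖μ‖ := by
  have := isFiniteMeasure_variation μ.toSigned
  have h := VectorMeasure.norm_integral_le_of_norm_le_const (μ := μ.toSigned) (f := g)
    (B := (ContinuousLinearMap.lsmul ℝ ℝ).flip) (C := c) (Eventually.of_forall hg)
  have h1 : ‖(ContinuousLinearMap.lsmul ℝ ℝ (E := ℝ)).flip‖ = 1 := by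
    rw [ContinuousLinearMap.opNorm_flip]
    exact ContinuousLinearMap.opNorm_lsmul ℝ ℝ
  rw [h1, mul_one] at h
  exact h

/-- Integration against a measure, as a continuous linear functional on continuous functions. -/
noncomputable def integralCLM (μ : RCA (StoneSpace B)) : C(StoneSpace B, ℝ) →L[ℝ] ℝ :=
  LinearMap.mkContinuous
    { toFun := μ.integral
      map_add' := fun g h => VectorMeasure.integral_fun_add (μ.integrable_continuousMap g)
        (μ.integrable_continuousMap h)
      map_smul' := fun c g => VectorMeasure.integral_fun_smul _ _ c g }
    ‖μ‖ fun g => by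
      rw [mul_comm]
      exact μ.abs_integral_le g g.norm_coe_le_norm

theorem integralCLM_apply (μ : RCA (StoneSpace B)) (g : C(StoneSpace B, ℝ)) :
    μ.integralCLM g = μ.integral g := rfl

theorem integral_indicatorK (μ : RCA (StoneSpace B)) (b : B) :
    μ.integral (indicatorK b) = μ.toBA b := by
  have := isFiniteMeasure_variation μ.toSigned
  refine (VectorMeasure.integral_indicator_const (1 : ℝ) (measurableSet_K b)).trans ?_
  simp [toBA_apply]

/-- A difference of two indicators takes values in `{-1, 0, 1}`, so it is a test function of norm at
most 1. This turns a bound on the functionals into one on `ba(B)`. -/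
theorem norm_toBA_le_opNorm (μ : RCA (StoneSpace B)) : ‖μ.toBA‖ ≤ ‖μ.integralCLM‖ := by
  refine BA.norm_le _ _ fun x y => ?_
  rw [← integral_indicatorK, ← integral_indicatorK, ← integralCLM_apply, ← integralCLM_apply,
    ← map_sub]
  refine (le_abs_self _).trans ((μ.integralCLM.le_opNorm _).trans
    (mul_le_of_le_one_right (norm_nonneg _) ?_))
  refine (ContinuousMap.norm_le _ zero_le_one).2 fun z => ?_
  rw [ContinuousMap.sub_apply, indicatorK_apply, indicatorK_apply]
  by_cases hx : z ∈ K x <;> by_cases hy : z ∈ K y <;> simp [hx, hy]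

theorem exists_norm_le_of_tendsto_integral {ν : ℕ → RCA (StoneSpace B)}
    (h : ∀ g : C(StoneSpace B, ℝ), ∃ l : ℝ, Tendsto (fun n => (ν n).integral g) atTop (𝓝 l)) :
    ∃ M : ℝ, ∀ n, ‖(ν n).toBA‖ ≤ M := by
  obtain ⟨M, hM⟩ := banach_steinhaus (g := fun n => (ν n).integralCLM) fun g => by
    obtain ⟨l, hl⟩ := h g
    obtain ⟨c, hc⟩ := hl.norm.bddAbove_range
    exact ⟨c, fun n => hc ⟨n, rfl⟩⟩
  exact ⟨M, fun n => (ν n).norm_toBA_le_opNorm.trans (hM n)⟩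

/-- A norm-bounded sequence that converges on all sets `K b` converges weak*. -/
theorem tendsto_integral_of_tendsto_toBA {ν : ℕ → RCA (StoneSpace B)} {μ : RCA (StoneSpace B)}
    {M : ℝ} (hM : ∀ n, ‖(ν n).toBA‖ ≤ M)
    (h : ∀ b, Tendsto (fun n => (ν n).toBA b) atTop (𝓝 (μ.toBA b))) (g : C(StoneSpace B, ℝ)) :
    Tendsto (fun n => (ν n).integral g) atTop (𝓝 (μ.integral g)) := by
  have hspan : ∀ s ∈ Submodule.span ℝ (Set.range (indicatorK (B := B))),
      Tendsto (fun n => (ν n).integralCLM s) atTop (𝓝 (μ.integralCLM s)) := by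
    intro s hs
    induction hs using Submodule.span_induction with
    | mem s hs =>
      obtain ⟨b, rfl⟩ := hs
      simpa only [integralCLM_apply, integral_indicatorK] using h b
    | zero => simp
    | add s t _ _ hs ht => simpa only [map_add] using hs.add ht
    | smul c s _ hs => simpa only [map_smul] using hs.const_smul c
  have hM0 : 0 ≤ M := (norm_nonneg _).trans (hM 0)
  rw [Metric.tendsto_atTop]
  intro ε hε
  -- Replacing `g` by `s` costs at most `ε / (2 * R) * (M + ‖μ‖)` in total; the extra 1 keeps `R`
  -- positive and this cost strictly below `ε / 2`.
  set R := M + ‖μ‖ + 1 with hR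
  have hR0 : 0 < R := by positivity
  obtain ⟨s, hs, hgs⟩ := exists_mem_span_indicatorK_near g (div_pos hε (mul_pos two_pos hR0))
  obtain ⟨N, hN⟩ := Metric.tendsto_atTop.1 (hspan s hs) (ε / 2) (half_pos hε)
  refine ⟨N, fun n hn => ?_⟩
  have h1 := hN n hn
  have h2 := (ν n).abs_integral_le (g - s) hgs
  have h3 := μ.abs_integral_le (g - s) hgs
  rw [← integralCLM_apply, map_sub] at h2 h3
  rw [← norm_toBA] at h2
  have h4 : ε / (2 * R) * ‖(ν n).toBA‖ ≤ ε / (2 * R) * M :=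
    mul_le_mul_of_nonneg_left (hM n) (by positivity)
  have h5 : ε / (2 * R) * (M + ‖μ‖ + 1) = ε / 2 := by
    rw [← hR]
    field_simp
  have h6 : 0 < ε / (2 * R) := by positivity
  rw [← integralCLM_apply, ← integralCLM_apply]
  rw [Real.dist_eq, abs_lt] at h1 ⊢
  rw [abs_le] at h2 h3
  constructor <;> linarith [h1.1, h1.2, h2.1, h2.2, h3.1, h3.2]

theorem tendsto_integral_iff (ν : ℕ → RCA (StoneSpace B)) (μ : RCA (StoneSpace B)) :
    (∀ g : C(StoneSpace B, ℝ), Tendsto (fun n => (ν n).integral g) atTop (𝓝 (μ.integral g))) ↔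
      (∃ M : ℝ, ∀ n, ‖(ν n).toBA‖ ≤ M) ∧
        ∀ b : B, Tendsto (fun n => (ν n).toBA b) atTop (𝓝 (μ.toBA b)) := by
  refine ⟨fun h => ⟨exists_norm_le_of_tendsto_integral fun g => ⟨_, h g⟩, fun b => ?_⟩,
    fun ⟨⟨M, hM⟩, h⟩ => tendsto_integral_of_tendsto_toBA hM h⟩
  simpa only [integral_indicatorK] using h (indicatorK b)

/-- Additivity and the bound `M` pass to the pointwise limit, so surjectivity provides a measure
representing it. This reduces convergence without a given limit to convergence with one. -/
theorem exists_tendsto_toBA {ν : ℕ → RCA (StoneSpace B)} {M : ℝ} (hM : ∀ n, ‖(ν n).toBA‖ ≤ M)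
    (h : ∀ b, ∃ l : ℝ, Tendsto (fun n => (ν n).toBA b) atTop (𝓝 l)) :
    ∃ μ : RCA (StoneSpace B), ∀ b, Tendsto (fun n => (ν n).toBA b) atTop (𝓝 (μ.toBA b)) := by
  choose f hf using h
  have hadd : ∀ x y : B, x ⊓ y = ⊥ → f (x ⊔ y) = f x + f y := fun x y hxy =>
    tendsto_nhds_unique (hf _)
      (((hf x).add (hf y)).congr fun n => ((ν n).toBA.map_sup hxy).symm)
  have hbdd : ∃ C : ℝ, ∀ x, |f x| ≤ C := by
    refine ⟨M, fun x => le_of_tendsto (hf x).abs (Eventually.of_forall fun n => ?_)⟩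
    have h1 := (ν n).toBA.sub_le_norm x ⊥
    have h2 := (ν n).toBA.sub_le_norm ⊥ x
    rw [BA.map_bot] at h1 h2
    exact abs_le.2 ⟨by linarith [hM n], by linarith [hM n]⟩
  obtain ⟨μ, hμ⟩ := toBAₗᵢ_surjective (BA.ofFun f hadd hbdd)
  refine ⟨μ, fun b => ?_⟩
  have : μ.toBA = BA.ofFun f hadd hbdd := hμ
  rw [this]
  exact hf b

theorem exists_tendsto_integral_iff (ν : ℕ → RCA (StoneSpace B)) :
    (∀ g : C(StoneSpace B, ℝ), ∃ l : ℝ, Tendsto (fun n => (ν n).integral g) atTop (𝓝 l)) ↔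
      (∃ M : ℝ, ∀ n, ‖(ν n).toBA‖ ≤ M) ∧
        ∀ b : B, ∃ l : ℝ, Tendsto (fun n => (ν n).toBA b) atTop (𝓝 l) := by
  refine ⟨fun h => ⟨exists_norm_le_of_tendsto_integral h, fun b => ?_⟩, ?_⟩
  · simpa only [integral_indicatorK] using h (indicatorK b)
  · rintro ⟨⟨M, hM⟩, h⟩ g
    obtain ⟨μ, hμ⟩ := exists_tendsto_toBA hM h
    exact ⟨_, tendsto_integral_of_tendsto_toBA hM hμ g⟩

end RCA

theorem mainTheorem5 (B : Type*) [BooleanAlgebra B] :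
    CompleteSpace (RCA (StoneSpace B)) ∧ CompleteSpace (BA B) ∧
    ∃ C : RCA (StoneSpace B) ≃ₗᵢ[ℝ] BA B,
      (∀ (μ : RCA (StoneSpace B)) (b : B), C μ b = μ.toSigned (StoneSpace.K b)) ∧
      Set.BijOn C (RCA.probability (StoneSpace B)) (BA.normalized B) ∧
      -- sequences in `rca(S(B))`, with a prescribed limit
      (∀ (ν : ℕ → RCA (StoneSpace B)) (μ : RCA (StoneSpace B)),
        (∀ g : C(StoneSpace B, ℝ),
            Tendsto (fun n => (ν n).integral g) atTop (𝓝 (μ.integral g))) ↔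
          (∃ M : ℝ, ∀ n, ‖C (ν n)‖ ≤ M) ∧
            ∀ b : B, Tendsto (fun n => C (ν n) b) atTop (𝓝 (C μ b))) ∧
      -- sequences in `rca(S(B))`, without a prescribed limit
      (∀ ν : ℕ → RCA (StoneSpace B),
        (∀ g : C(StoneSpace B, ℝ), ∃ l : ℝ, Tendsto (fun n => (ν n).integral g) atTop (𝓝 l)) ↔
          (∃ M : ℝ, ∀ n, ‖C (ν n)‖ ≤ M) ∧
            ∀ b : B, ∃ l : ℝ, Tendsto (fun n => C (ν n) b) atTop (𝓝 l)) ∧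
      -- sequences of probability measures
      (∀ ν : ℕ → RCA (StoneSpace B), (∀ n, ν n ∈ RCA.probability (StoneSpace B)) →
        (∀ μ : RCA (StoneSpace B),
          (∀ g : C(StoneSpace B, ℝ),
              Tendsto (fun n => (ν n).integral g) atTop (𝓝 (μ.integral g))) ↔
            ∀ b : B, Tendsto (fun n => C (ν n) b) atTop (𝓝 (C μ b))) ∧
        ((∀ g : C(StoneSpace B, ℝ), ∃ l : ℝ, Tendsto (fun n => (ν n).integral g) atTop (𝓝 l)) ↔
          ∀ b : B, ∃ l : ℝ, Tendsto (fun n => C (ν n) b) atTop (𝓝 l))) := by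

  refine ⟨inferInstance, inferInstance, RCA.equivBA B, fun _ _ => rfl, RCA.bijOn_equivBA,
    RCA.tendsto_integral_iff, RCA.exists_tendsto_integral_iff, fun ν hν => ?_⟩
  have hbdd : ∃ M : ℝ, ∀ n, ‖(ν n).toBA‖ ≤ M :=
    ⟨1, fun n => BA.norm_le_one_of_mem_normalized (RCA.bijOn_equivBA.mapsTo (hν n))⟩
  exact ⟨fun μ => (RCA.tendsto_integral_iff ν μ).trans (and_iff_right hbdd),
    (RCA.exists_tendsto_integral_iff ν).trans (and_iff_right hbdd)⟩
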